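/- Let $\Delta$ be a thick, locally finite building of type $\widetilde A_2$, whose vertices $v$ have types $\tau(v)\in\mathbb Z/3\mathbb Z$, each chamber having exactly one vertex of each type. Edges are directed from a vertex of type $i$ to a vertex of type $i+1$. Let $\Gamma$ be a torsion-free $\widetilde A_2$ group acting on $\Delta$, that is, a torsion-free group of type rotating automorphisms of $\Delta$ (each $g\in\Gamma$ satisfies $\tau(gv)=\tau(v)+i$ for all $v$, with some $i$ depending on $g$) acting freely and transitively on the vertices of $\Delta$. Let $P$ be the set of $\Gamma$-orbits of directed edges, and let $\widehat X^2$ be the set of $\Gamma$-orbits of directed chambers, i.e. chambers with a specified base vertex. A directed chamber $\sigma$ with base vertex $v_0$ and other vertices $v_1,v_2$ of types $\tau(v_0)+1$, $\tau(v_0)+2$ represents $a=\langle a_0,a_1,a_2\rangle\in\widehat X^2$, where $a_0,a_1,a_2\in P$ are the orbits of the edges $v_1\to v_2$, $v_2\to v_0$, $v_0\to v_1$. In the link of a vertex $u$, which is a projective plane, call the neighbours of $u$ of type $\tau(u)+1$ points and those of type $\tau(u)+2$ lines; a point and a line are incident if they are adjacent to each other. For $a,b\in\widehat X^2$ put $m_{ab}=1$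 if $a,b$ have representatives $(v_0,v_1,v_2)$, $(w_0,w_1,w_2)$ with $w_0=v_1$ such that, in the link of $v_1$, the point $w_1$ is not on the line $v_0$ and the point $v_2$ is on the line $w_2$; otherwise $m_{ab}=0$. Put $n_{ab}=1$ if $a,b$ have representatives $(v_0,v_1,v_2)$, $(w_0,w_1,w_2)$ with $w_0=v_2$ such that, in the link of $v_2$, the point $v_0$ is not on the line $w_2$ and the point $w_1$ is on the line $v_1$; otherwise $n_{ab}=0$. Let $C(\Gamma)$ be the abelian group with generating set $\widehat X^2$ and relations $$a=\sum_{b\in\widehat X^2}m_{ab}\,b=\sum_{b\in\widehat X^2}n_{ab}\,b,\qquad a\in\widehat X^2 .$$ Let $C_0(\Gamma)$ be the abelian group with generating set $\widehat X^2$ and relations $$\langle a_0,a_1,a_2\rangle=\langle a_1,a_2,a_0\rangle=\langle a_2,a_0,a_1\rangle,\quad \langle a_0,a_1,a_2\rangle\in\widehat X^2;\qquad \langle\xi\rangle=0=\langle\overline\xi\rangle,\quad \xi\in P,$$ where $\langle\xi\rangle=\sum_{a_2=\xi}a$ and $\langle\overline\xi\rangle=\sum_{a_1=\xi}a$. Then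 $C(\Gamma)\otimes\mathbb R=C_0(\Gamma)\otimes\mathbb R$: the identity on the common generating set $\widehat X^2$ induces an isomorphism of real vector spaces between them. -/

import Mathlib

open scoped TensorProduct

noncomputable section

namespace A2Tilde

/-- The vertices of the upward triangle `{x, x + e₁, x + e₂}` of the triangular lattice
`ℤ e₁ + ℤ e₂`, where `e₁, e₂` are unit vectors at angle `π / 3`. -/
def upTriangle (x : ℤ × ℤ) : Finset (ℤ × ℤ) := {x, x + (1, 0), x + (0, 1)}

/-- The vertices of the downward triangle `{x, x + e₁, x + e₁ - e₂}`. -/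
def downTriangle (x : ℤ × ℤ) : Finset (ℤ × ℤ) := {x, x + (1, 0), x + (1, -1)}

/-- The Coxeter complex of type `Ã₂`: the tessellation of the Euclidean plane by equilateral
triangles, with vertex set the triangular lattice. -/
def coxeterComplex : AbstractSimplicialComplex (ℤ × ℤ) where
  faces := {s | s.Nonempty ∧ ∃ x, s ⊆ upTriangle x ∨ s ⊆ downTriangle x}
  isRelLowerSet_faces := by
    rintro s ⟨hs, x, hx⟩
    refine ⟨hs, fun t hts ht => ⟨ht, x, ?_⟩⟩
    exact hx.imp (fun h => subset_trans hts h) (fun h => subset_trans hts h)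
  singleton_mem := fun v =>
    ⟨Finset.singleton_nonempty v, v, Or.inl (by simp [upTriangle])⟩

/-- `𝒜` is a system of apartments of type `Ã₂` for the simplicial complex `K`, in the sense of
the axioms of a building. A subcomplex is given by its set of simplices. -/
structure IsApartmentSystem {V : Type*} [DecidableEq V] (K : AbstractSimplicialComplex V)
    (𝒜 : Set (Set (Finset V))) : Prop where
  /-- Apartments are subcomplexes. -/
  subset_faces : ∀ A ∈ 𝒜, A ⊆ K.faces
  /-- Each apartment is isomorphic to the Coxeter complex. -/
  exists_chart : ∀ A ∈ 𝒜, ∃ f : ℤ × ℤ ↪ V, A = {t | ∃ s ∈ coxeterComplex.faces, t = s.map f}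
  /-- Any two simplices lie in a common apartment. -/
  exists_common : ∀ s ∈ K.faces, ∀ t ∈ K.faces, ∃ A ∈ 𝒜, s ∈ A ∧ t ∈ A
  /-- If two apartments both contain the simplices `s` and `t`, there is an isomorphism between
  them which fixes `s` and `t` pointwise. -/
  exists_iso : ∀ A ∈ 𝒜, ∀ B ∈ 𝒜, ∀ s t : Finset V, s ∈ A → t ∈ A → s ∈ B → t ∈ B →
    ∃ φ : V → V, Set.InjOn φ {v | {v} ∈ A} ∧ (fun r : Finset V => r.image φ) '' A = B ∧
      (∀ v ∈ s, φ v = v) ∧ (∀ v ∈ t, φ v = v)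

/-- A (thick) locally finite building of type `Ã₂` with vertex set `V`, together with its type
function to `ℤ/3ℤ`. -/
structure Building (V : Type*) [DecidableEq V] extends AbstractSimplicialComplex V where
  nonempty : Nonempty V
  /-- The type of a vertex. -/
  typ : V → ZMod 3
  /-- The vertices of a simplex have different types (so a chamber, which has three vertices,
  has exactly one vertex of each type). -/
  typ_injOn : ∀ s ∈ faces, Set.InjOn typ (s : Set V)
  exists_apartmentSystem : ∃ 𝒜, IsApartmentSystem toAbstractSimplicialComplex 𝒜
  /-- Thickness: each edge lies in at least three chambers. -/
  thick : ∀ e ∈ faces, e.card = 2 → 3 ≤ {s ∈ faces | e ⊆ s ∧ s.card = 3}.encard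
  locallyFinite : ∀ v, {s ∈ faces | v ∈ s}.Finite

variable {V : Type*} [DecidableEq V]

/-- `Γ` is an `Ã₂` group with respect to its action on the vertices of the building `Δ`: a group
of type rotating automorphisms of `Δ`, acting freely and transitively on the vertex set. -/
structure IsA2TildeGroup (Δ : Building V) (Γ : Type*) [Group Γ] [MulAction Γ V] : Prop where
  smul_mem_faces : ∀ (g : Γ), ∀ s ∈ Δ.faces, s.image (fun v => g • v) ∈ Δ.faces
  typeRotating : ∀ g : Γ, ∃ i : ZMod 3, ∀ v : V, Δ.typ (g • v) = Δ.typ v + i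
  free : ∀ (g : Γ) (v : V), g • v = v → g = 1
  transitive : ∀ v w : V, ∃ g : Γ, g • v = w

/-- A directed edge of `Δ`: its final vertex has type one more than its initial vertex. -/
structure Edge (Δ : Building V) where
  src : V
  tgt : V
  mem_faces : {src, tgt} ∈ Δ.faces
  typ_tgt : Δ.typ tgt = Δ.typ src + 1

/-- A directed 2-simplex of `Δ`, that is a chamber with a specified base vertex. Drawn with the
base vertex at the bottom, the other two vertices are `right`, whose type is one more than
that of the base, and `left`, whose type is two more. -/
@[ext]
structure Chamber (Δ : Building V) where
  base : V
  right : V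
  left : V
  mem_faces : {base, right, left} ∈ Δ.faces
  typ_right : Δ.typ right = Δ.typ base + 1
  typ_left : Δ.typ left = Δ.typ base + 2

namespace Chamber

variable {Δ : Building V}

/-- The edge `a₀`, opposite to the base vertex. -/
def edge₀ (x : Chamber Δ) : Edge Δ where
  src := x.right
  tgt := x.left
  mem_faces := Δ.isRelLowerSet_faces x.mem_faces |>.2
    (by intro y; simp only [Finset.mem_insert, Finset.mem_singleton]; tauto) (by simp)
  typ_tgt := by rw [x.typ_left, x.typ_right, add_assoc]; rfl

/-- The edge `a₁`, from the left vertex to the base vertex. -/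
def edge₁ (x : Chamber Δ) : Edge Δ where
  src := x.left
  tgt := x.base
  mem_faces := Δ.isRelLowerSet_faces x.mem_faces |>.2
    (by intro y; simp only [Finset.mem_insert, Finset.mem_singleton]; tauto) (by simp)
  typ_tgt := by
    rw [x.typ_left, add_assoc, show (2 + 1 : ZMod 3) = 0 from rfl, add_zero]

/-- The edge `a₂`, from the base vertex to the right vertex. -/
def edge₂ (x : Chamber Δ) : Edge Δ where
  src := x.base
  tgt := x.right
  mem_faces := Δ.isRelLowerSet_faces x.mem_faces |>.2
    (by intro y; simp only [Finset.mem_insert, Finset.mem_singleton]; tauto) (by simp)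
  typ_tgt := x.typ_right

/-- The same chamber with the base vertex moved to `right`; this turns `⟨a₀, a₁, a₂⟩` into
`⟨a₁, a₂, a₀⟩`. -/
def rotate (x : Chamber Δ) : Chamber Δ where
  base := x.right
  right := x.left
  left := x.base
  mem_faces := by
    have h : ({x.right, x.left, x.base} : Finset V) = {x.base, x.right, x.left} := by
      ext y; simp only [Finset.mem_insert, Finset.mem_singleton]; tauto
    rw [h]; exact x.mem_faces
  typ_right := x.edge₀.typ_tgt
  typ_left := by
    rw [x.typ_right, add_assoc, show (1 + 2 : ZMod 3) = 0 from rfl, add_zero]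

/-- The relative position of directed chambers which defines `m_{ab} = 1`: the base of `y` is the
right vertex `u` of `x`, and, in the projective plane which is the link of `u` (points: neighbours
of type one more than `u`; lines: neighbours of type two more), the point `y.right` is not on the
line `x.base`, and the line `y.left` passes through the point `x.left` (as well as through
`y.right`). So `x`, `{u, x.left, y.left}`, `y` are three successive chambers around `u`. -/
def PosM (x y : Chamber Δ) : Prop :=
  y.base = x.right ∧ {x.right, x.base, y.right} ∉ Δ.faces ∧ {x.right, x.left, y.left} ∈ Δ.faces

/-- The relative position which defines `n_{ac} = 1`: the base of `z` is the left vertex `u` of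
`x`, and, in the link of `u`, the point `x.base` is not on the line `z.left`, and the point
`z.right` is on the line `x.right` (as well as on `z.left`). So `x`, `{u, x.right, z.right}`, `z`
are three successive chambers around `u`. -/
def PosN (x z : Chamber Δ) : Prop :=
  z.base = x.left ∧ {x.left, x.base, z.left} ∉ Δ.faces ∧ {x.left, x.right, z.right} ∈ Δ.faces

end Chamber

section Quotient

variable (Δ : Building V) (Γ : Type*) [Group Γ] [MulAction Γ V]

/-- Directed edges are equivalent when they are in the same `Γ`-orbit. -/
def edgeSetoid : Setoid (Edge Δ) where
  r e f := ∃ g : Γ, g • e.src = f.src ∧ g • e.tgt = f.tgt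
  iseqv :=
    { refl := fun e => ⟨1, one_smul _ _, one_smul _ _⟩
      symm := by
        rintro e f ⟨g, h₁, h₂⟩
        exact ⟨g⁻¹, by rw [← h₁, inv_smul_smul], by rw [← h₂, inv_smul_smul]⟩
      trans := by
        rintro e f k ⟨g, h₁, h₂⟩ ⟨g', h₁', h₂'⟩
        exact ⟨g' * g, by rw [mul_smul, h₁, h₁'], by rw [mul_smul, h₂, h₂']⟩ }

/-- Directed chambers are equivalent when they are in the same `Γ`-orbit. -/
def chamberSetoid : Setoid (Chamber Δ) where
  r x y := ∃ g : Γ, g • x.base = y.base ∧ g • x.right = y.right ∧ g • x.left = y.left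
  iseqv :=
    { refl := fun x => ⟨1, one_smul _ _, one_smul _ _, one_smul _ _⟩
      symm := by
        rintro x y ⟨g, h₁, h₂, h₃⟩
        exact ⟨g⁻¹, by rw [← h₁, inv_smul_smul], by rw [← h₂, inv_smul_smul],
          by rw [← h₃, inv_smul_smul]⟩
      trans := by
        rintro x y z ⟨g, h₁, h₂, h₃⟩ ⟨g', h₁', h₂', h₃'⟩
        exact ⟨g' * g, by rw [mul_smul, h₁, h₁'], by rw [mul_smul, h₂, h₂'],
          by rw [mul_smul, h₃, h₃']⟩ }

/-- The set of oriented edges of `X = Γ \ Δ`. For an `Ã₂` group it is identified with the set `P`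
of generators of `Γ`: the orbit of the edge from `γ v` to `γ ξ v` has the label `ξ`. -/
def EdgeLabel : Type _ := Quotient (edgeSetoid Δ Γ)

/-- The set of directed 2-cells of `X = Γ \ Δ`. -/
def DirectedCell : Type _ := Quotient (chamberSetoid Δ Γ)

namespace DirectedCell

variable {Δ Γ}

/-- The edge `a₁` of a directed 2-cell `a = ⟨a₀, a₁, a₂⟩`. -/
def edge₁ : DirectedCell Δ Γ → EdgeLabel Δ Γ :=
  Quotient.map' (s₁ := chamberSetoid Δ Γ) (s₂ := edgeSetoid Δ Γ) Chamber.edge₁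
    (fun _ _ ⟨g, h₁, _, h₃⟩ => ⟨g, h₃, h₁⟩)

/-- The edge `a₂` of a directed 2-cell `a = ⟨a₀, a₁, a₂⟩`. -/
def edge₂ : DirectedCell Δ Γ → EdgeLabel Δ Γ :=
  Quotient.map' (s₁ := chamberSetoid Δ Γ) (s₂ := edgeSetoid Δ Γ) Chamber.edge₂
    (fun _ _ ⟨g, h₁, h₂, _⟩ => ⟨g, h₁, h₂⟩)

/-- The directed 2-cell `⟨a₁, a₂, a₀⟩` obtained from `⟨a₀, a₁, a₂⟩`. -/
def rotate : DirectedCell Δ Γ → DirectedCell Δ Γ :=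
  Quotient.map' (s₁ := chamberSetoid Δ Γ) (s₂ := chamberSetoid Δ Γ) Chamber.rotate
    (fun _ _ ⟨g, h₁, h₂, h₃⟩ => ⟨g, h₂, h₃, h₁⟩)

end DirectedCell

/-- The set of directed 2-cells is finite, so that the sums below are finite sums. -/
theorem finite_directedCell (hΓ : IsA2TildeGroup Δ Γ) : Finite (DirectedCell Δ Γ) := by
  obtain ⟨v⟩ := Δ.nonempty
  let F : Set V := ⋃ s ∈ {s ∈ Δ.faces | v ∈ s}, (s : Set V)
  have hF : F.Finite := (Δ.locallyFinite v).biUnion fun s _ => s.finite_toSet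
  let S : Set (Chamber Δ) := {x | x.base = v}
  have hS : S.Finite := by
    refine Set.Finite.of_finite_image (f := fun x : Chamber Δ => (x.right, x.left))
      ((hF.prod hF).subset ?_) ?_
    · rintro _ ⟨x, hx, rfl⟩
      have hx' : v ∈ ({x.base, x.right, x.left} : Finset V) := by
        rw [← show x.base = v from hx]; simp
      exact ⟨Set.mem_biUnion (show _ ∈ {s ∈ Δ.faces | v ∈ s} from ⟨x.mem_faces, hx'⟩) (by simp),
        Set.mem_biUnion (show _ ∈ {s ∈ Δ.faces | v ∈ s} from ⟨x.mem_faces, hx'⟩) (by simp)⟩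
    · intro x hx y hy hxy
      obtain ⟨h₁, h₂⟩ := Prod.mk.inj hxy
      exact Chamber.ext ((show x.base = v from hx).trans (show y.base = v from hy).symm) h₁ h₂
  have : Finite S := hS
  refine Finite.of_surjective (fun x : S => (Quotient.mk (chamberSetoid Δ Γ) x.1)) ?_
  intro a
  induction a using Quotient.inductionOn with
  | h x =>
    obtain ⟨g, hg⟩ := hΓ.transitive x.base v
    obtain ⟨i, hi⟩ := hΓ.typeRotating g
    refine ⟨⟨⟨g • x.base, g • x.right, g • x.left, ?_, ?_, ?_⟩, hg⟩, ?_⟩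
    · have := hΓ.smul_mem_faces g _ x.mem_faces
      simpa [Finset.image_insert] using this
    · rw [hi, hi, x.typ_right]; ring
    · rw [hi, hi, x.typ_left]; ring
    · exact Quotient.sound ⟨g⁻¹, inv_smul_smul _ _, inv_smul_smul _ _, inv_smul_smul _ _⟩

open Classical in
/-- The transition matrix `M`. -/
def transM : Matrix (DirectedCell Δ Γ) (DirectedCell Δ Γ) ℤ := fun a b =>
  if ∃ x y : Chamber Δ, Quotient.mk (chamberSetoid Δ Γ) x = a ∧
    Quotient.mk (chamberSetoid Δ Γ) y = b ∧ x.PosM y then 1 else 0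

open Classical in
/-- The transition matrix `N`. -/
def transN : Matrix (DirectedCell Δ Γ) (DirectedCell Δ Γ) ℤ := fun a b =>
  if ∃ x y : Chamber Δ, Quotient.mk (chamberSetoid Δ Γ) x = a ∧
    Quotient.mk (chamberSetoid Δ Γ) y = b ∧ x.PosN y then 1 else 0

open FreeAbelianGroup in
/-- The relations `a = ∑ m_{ab} b` and `a = ∑ n_{ab} b` of `C(Γ)`. -/
def relations : Set (FreeAbelianGroup (DirectedCell Δ Γ)) :=
  {r | ∃ a, r = of a - ∑ᶠ b, transM Δ Γ a b • of b} ∪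
  {r | ∃ a, r = of a - ∑ᶠ b, transN Δ Γ a b • of b}

/-- The group `C(Γ)`: generated by the directed 2-cells, with the transition relations. -/
abbrev GroupC : Type _ :=
  FreeAbelianGroup (DirectedCell Δ Γ) ⧸ AddSubgroup.closure (relations Δ Γ)

/-- The sum `⟨ξ⟩` of all directed 2-cells `a` with `a₂ = ξ`. -/
def edgeSum (ξ : EdgeLabel Δ Γ) : FreeAbelianGroup (DirectedCell Δ Γ) :=
  ∑ᶠ (a : DirectedCell Δ Γ) (_ : a.edge₂ = ξ), FreeAbelianGroup.of a

/-- The sum `⟨ξ̄⟩` of all directed 2-cells `a` with `a₁ = ξ`. -/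
def invEdgeSum (ξ : EdgeLabel Δ Γ) : FreeAbelianGroup (DirectedCell Δ Γ) :=
  ∑ᶠ (a : DirectedCell Δ Γ) (_ : a.edge₁ = ξ), FreeAbelianGroup.of a

open FreeAbelianGroup in
/-- The relations of `C₀(Γ)`: `⟨a₀, a₁, a₂⟩ = ⟨a₁, a₂, a₀⟩ = ⟨a₂, a₀, a₁⟩` and
`⟨ξ⟩ = 0 = ⟨ξ̄⟩`. -/
def relations₀ : Set (FreeAbelianGroup (DirectedCell Δ Γ)) :=
  {r | ∃ a : DirectedCell Δ Γ, r = of a - of a.rotate} ∪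
  {r | ∃ a : DirectedCell Δ Γ, r = of a.rotate - of a.rotate.rotate} ∪
  {r | ∃ ξ, r = edgeSum Δ Γ ξ} ∪
  {r | ∃ ξ, r = invEdgeSum Δ Γ ξ}

/-- The group `C₀(Γ)`: generated by the directed 2-cells, with the relations `relations₀`. -/
abbrev GroupC₀ : Type _ :=
  FreeAbelianGroup (DirectedCell Δ Γ) ⧸ AddSubgroup.closure (relations₀ Δ Γ)

variable {Δ Γ}

/-- The generator of `C(Γ)` given by a directed 2-cell. -/
def GroupC.of (a : DirectedCell Δ Γ) : GroupC Δ Γ :=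
  QuotientAddGroup.mk (FreeAbelianGroup.of a)

/-- The generator of `C₀(Γ)` given by a directed 2-cell. -/
def GroupC₀.of (a : DirectedCell Δ Γ) : GroupC₀ Δ Γ :=
  QuotientAddGroup.mk (FreeAbelianGroup.of a)

end Quotient

end A2Tilde

end

/-! A real vector space given by generators and relations is determined by its linear functionals,
so it suffices that a function `f` on directed cells satisfies the transition equations exactly when
it satisfies the relations of `C₀(Γ)` (`transition_iff`; `exists_linearEquiv` turns this into the
isomorphism).

Fix a vertex `o`. Since the action is free and transitive on vertices, directed cells correspond to
flags `(p, l)` of the link of `o`, a finite projective plane of order `q ≥ 2`, and edge labels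
correspond both to its points and to its lines. So `f` becomes a function `φ` on flags, and `⟨ξ⟩ = 0
= ⟨ξ̄⟩` says that `φ` sums to zero over the lines through each point and over the points of each
line.

If these sums vanish, incidence geometry shows that the `M` and `N` sums attached to a flag `(p₀,
l₀)` both equal `φ p₀ l₀` (`IsPlane.sum_sum_eq_of_sum_eq_zero`). The transition equations then say
precisely that `f` is invariant under rotation.

It remains to deduce the vanishing from the transition equations. Put `F p = ∑ l, φ p l`. Summing
the `M` equations over the points of a line `l` gives `F (σ l) = ∑_{p ∉ l} F p`, where the bijection
`σ` matches lines and points with the same label. Summing over `l` gives `∑ F = q² ∑ F`, so `∑ F =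
0`; summing squares gives `∑ F² = q ∑ F²`, so `F = 0` (`IsPlane.eq_zero_of_sum_eq`). The `N`
equations treat the sums over points dually. -/

namespace A2Tilde

/-! ### Summation identities in finite projective planes. -/

/-- The incidence relation `I` between points and lines is that of a finite projective plane of
order `q ≥ 2`. -/
structure IsPlane {P L : Type*} [Fintype P] [Fintype L] (I : P → L → Prop) (q : ℕ) : Prop where
  two_le : 2 ≤ q
  card_lines : ∀ p, Nat.card {l // I p l} = q + 1
  card_points : ∀ l, Nat.card {p // I p l} = q + 1
  join : ∀ p p', p ≠ p' → ∃! l, I p l ∧ I p' l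
  meet : ∀ l l', l ≠ l' → ∃! p, I p l ∧ I p l'

namespace IsPlane

variable {P L : Type*} [Fintype P] [Fintype L] {I : P → L → Prop} {q : ℕ}

theorem flip (h : IsPlane I q) : IsPlane (fun l p => I p l) q :=
  ⟨h.two_le, h.card_points, h.card_lines, h.meet, h.join⟩

open Classical in
theorem sum_lines (h : IsPlane I q) (p : P) : (∑ l, if I p l then (1 : ℝ) else 0) = q + 1 := by
  have := h.card_lines p
  rw [Nat.card_eq_fintype_card, Fintype.card_subtype] at this
  rw [Finset.sum_boole, this]; push_cast; rfl

open Classical in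
theorem sum_join (h : IsPlane I q) {p p' : P} (hp : p ≠ p') :
    (∑ l, if I p l ∧ I p' l then (1 : ℝ) else 0) = 1 := by
  obtain ⟨l, hl, hu⟩ := h.join p p' hp
  rw [Finset.sum_boole, show Finset.univ.filter (fun l => I p l ∧ I p' l) = {l} by
    ext m; simp only [Finset.mem_filter, Finset.mem_univ, true_and, Finset.mem_singleton]
    exact ⟨hu m, fun e => e ▸ hl⟩]
  simp

open Classical in
/-- `∑ₗ (∑_{p ∈ l} F p)² = q ∑ F² + (∑ F)²`. -/
theorem sum_sq (h : IsPlane I q) (F : P → ℝ) :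
    ∑ l, (∑ p, if I p l then F p else 0) ^ 2 = q * ∑ p, F p ^ 2 + (∑ p, F p) ^ 2 := by
  -- The incidence matrix `A` satisfies `A Aᵀ = q • 1 + J`, with `J` the all-ones matrix: two points
  -- share one line if distinct and `q + 1` if equal.
  have h1 : ∀ p p', (∑ l, if I p l ∧ I p' l then (1 : ℝ) else 0) =
      1 + if p = p' then (q : ℝ) else 0 := by
    intro p p'
    split_ifs with hp
    · subst hp; simp only [and_self]; rw [h.sum_lines]; ring
    · rw [h.sum_join hp, add_zero]
  calc ∑ l, (∑ p, if I p l then F p else 0) ^ 2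
      = ∑ l, ∑ p, ∑ p', F p * F p' * (if I p l ∧ I p' l then (1 : ℝ) else 0) := by
        refine Finset.sum_congr rfl fun l _ => ?_
        rw [sq, Finset.sum_mul_sum]
        refine Finset.sum_congr rfl fun p _ => Finset.sum_congr rfl fun p' _ => ?_
        by_cases h1 : I p l <;> by_cases h2 : I p' l <;> simp [h1, h2]
    _ = ∑ p, ∑ p', F p * F p' * (∑ l, if I p l ∧ I p' l then (1 : ℝ) else 0) := by
        rw [Finset.sum_comm]
        refine Finset.sum_congr rfl fun p _ => ?_
        rw [Finset.sum_comm]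
        simp only [Finset.mul_sum]
    _ = _ := by
        simp only [h1, mul_add, mul_one, Finset.sum_add_distrib, mul_ite, mul_zero,
          Finset.sum_ite_eq, Finset.mem_univ, if_true]
        rw [sq (∑ p, F p), Finset.sum_mul_sum, Finset.mul_sum, add_comm]
        congr 1
        exact Finset.sum_congr rfl fun p _ => by ring

open Classical in
/-- The edge transition matrix of a finite projective plane has no eigenvalue `1`. -/
theorem eq_zero_of_sum_eq (h : IsPlane I q) (σ : L → P) (hσ : Function.Bijective σ) (F : P → ℝ)
    (hF : ∀ l, F (σ l) = ∑ p, if I p l then 0 else F p) (p : P) : F p = 0 := by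
  have hq : (2 : ℝ) ≤ q := by exact_mod_cast h.two_le
  have hσs : ∀ f : P → ℝ, ∑ l, f (σ l) = ∑ p, f p := fun f => hσ.sum_comp f
  have hB : ∀ l, F (σ l) = ∑ p, F p - ∑ p, if I p l then F p else 0 := by
    intro l
    rw [hF, ← Finset.sum_sub_distrib]
    exact Finset.sum_congr rfl fun p _ => by split_ifs <;> simp
  have hsum : ∑ l, ∑ p, (if I p l then F p else 0) = (q + 1) * ∑ p, F p := by
    rw [Finset.sum_comm, Finset.mul_sum]
    refine Finset.sum_congr rfl fun p _ => ?_
    rw [← h.sum_lines p, Finset.sum_mul]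
    exact Finset.sum_congr rfl fun l _ => by split_ifs <;> simp
  have hcard : (Fintype.card L : ℝ) = q ^ 2 + q + 1 := by
    -- For the constant function `1` the dual identity reads `(q + 1)² |P| = q |L| + |L|²`, and `|P|
    -- = |L|` by `σ`.
    have := h.flip.sum_sq (fun _ => (1 : ℝ))
    have h2 : ∀ p, (∑ l, if I p l then (1 : ℝ) else 0) = q + 1 := h.sum_lines
    simp only [h2] at this
    simp only [Finset.sum_const, Finset.card_univ, one_pow, nsmul_eq_mul, mul_one] at this
    rw [show Fintype.card P = Fintype.card L from (Fintype.card_of_bijective hσ).symm] at this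
    have hpos : (Fintype.card L : ℝ) ≠ 0 := by
      have : Nonempty L := ⟨(hσ.2 p).choose⟩
      exact_mod_cast Fintype.card_ne_zero
    have h3 : (Fintype.card L : ℝ) * (Fintype.card L - (q ^ 2 + q + 1)) = 0 := by linarith
    have := (mul_eq_zero.1 h3).resolve_left hpos
    linarith
  have hzero : ∑ p, F p = 0 := by
    -- Summing `hB` over all lines multiplies `∑ F` by `|L| - (q + 1) = q²`, which is not `1`.
    have h1 := hσs F
    simp only [hB, Finset.sum_sub_distrib, hsum] at h1
    rw [Finset.sum_const, Finset.card_univ, nsmul_eq_mul, hcard] at h1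
    have : ((q : ℝ) ^ 2 - 1) * ∑ p, F p = 0 := by linarith
    refine (mul_eq_zero.1 this).resolve_left ?_
    nlinarith
  -- With total sum zero, `F (σ l)` is minus the sum of `F` over `l`; comparing sums of squares
  -- gives `q ∑ F² = ∑ F²`.
  have hsq := h.sum_sq F
  have h2 := hσs (fun p => F p ^ 2)
  simp only [hB, hzero, zero_sub, neg_sq] at h2
  rw [hsq, hzero] at h2
  have h3 : ∑ p, F p ^ 2 = 0 := by
    have : ((q : ℝ) - 1) * ∑ p, F p ^ 2 = 0 := by linarith
    refine (mul_eq_zero.1 this).resolve_left ?_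
    linarith
  have := (Finset.sum_eq_zero_iff_of_nonneg (fun p _ => sq_nonneg (F p))).1 h3 p (Finset.mem_univ p)
  exact pow_eq_zero_iff (two_ne_zero) |>.1 this

-- Sort the flags by the line `l` through `p₀`. The line `l₀` contributes nothing. Any other `l`
-- meets `l₀` only in `p₀`, so its points off `l₀` are all its points but `p₀`, and they contribute
-- `-φ p₀ l` because `φ` sums to zero along `l`. Since `φ` also sums to zero around `p₀`, what
-- remains is `φ p₀ l₀`.
open Classical in
theorem sum_sum_eq_of_sum_eq_zero (h : IsPlane I q) (φ : P → L → ℝ)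
    (hφ : ∀ p l, ¬ I p l → φ p l = 0) (hP : ∀ p, ∑ l, φ p l = 0) (hL : ∀ l, ∑ p, φ p l = 0)
    {p₀ : P} {l₀ : L} (h₀ : I p₀ l₀) :
    (∑ p, ∑ l, if ¬ I p l₀ ∧ I p₀ l then φ p l else 0) = φ p₀ l₀ := by
  rw [Finset.sum_comm]
  have key : ∀ l, (∑ p, if ¬ I p l₀ ∧ I p₀ l then φ p l else 0) =
      (if l = l₀ then φ p₀ l₀ else 0) - φ p₀ l := by
    intro l
    by_cases hl : I p₀ l
    · split_ifs with e
      · subst e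
        rw [sub_self]
        refine Finset.sum_eq_zero fun p _ => ?_
        split_ifs with hp
        · exact hφ _ _ hp.1
        · rfl
      · rw [zero_sub, eq_neg_iff_add_eq_zero]
        refine Eq.trans ?_ (hL l)
        rw [← Finset.sum_erase_add _ _ (Finset.mem_univ p₀)]
        rw [← Finset.sum_erase_add (Finset.univ) (fun p => φ p l) (Finset.mem_univ p₀)]
        congr 1
        rw [if_neg (by simp [h₀]), add_zero]
        refine Finset.sum_congr rfl fun p hp => ?_
        have hp := Finset.ne_of_mem_erase hp
        split_ifs with hi
        · rfl
        · refine (hφ _ _ fun hpl => hp ?_).symm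
          have hpl₀ : I p l₀ := by by_contra hn; exact hi ⟨hn, hl⟩
          exact (h.meet l l₀ e).unique ⟨hpl, hpl₀⟩ ⟨hl, h₀⟩
    · rw [hφ p₀ l hl, sub_zero, if_neg (fun e : l = l₀ => hl (e ▸ h₀))]
      exact Finset.sum_eq_zero fun p _ => if_neg fun hi => hl hi.2
  simp only [key, Finset.sum_sub_distrib, hP, Finset.sum_ite_eq', Finset.mem_univ, if_true,
    sub_zero]

-- Double counting: a flag `(p, l)` with `p` off `l₀` has `l ≠ l₀`, hence is counted for exactly one
-- `p₀`, the intersection of `l` and `l₀`.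
open Classical in
theorem sum_sum_sum_eq (h : IsPlane I q) (φ : P → L → ℝ) (hφ : ∀ p l, ¬ I p l → φ p l = 0)
    (l₀ : L) :
    (∑ p₀, if I p₀ l₀ then ∑ p, ∑ l, (if ¬ I p l₀ ∧ I p₀ l then φ p l else 0) else 0) =
      ∑ p, if I p l₀ then 0 else ∑ l, φ p l := by
  have h1 : ∀ p l, (∑ p₀, if I p₀ l₀ then (if ¬ I p l₀ ∧ I p₀ l then φ p l else 0) else 0) =
      if I p l₀ then 0 else φ p l := by
    intro p l
    by_cases hp : I p l₀
    · simp [hp]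
    by_cases hpl : I p l
    · have hl : l ≠ l₀ := fun e => hp (e ▸ hpl)
      have := h.flip.sum_join hl
      rw [if_neg hp]
      refine Eq.trans ?_ (mul_one (φ p l))
      rw [← this, Finset.mul_sum]
      refine Finset.sum_congr rfl fun p₀ _ => ?_
      by_cases h2 : I p₀ l₀ <;> by_cases h3 : I p₀ l <;> simp [h2, h3, hp]
    · simp [hφ p l hpl]
  calc _ = ∑ p₀, ∑ p, ∑ l, (if I p₀ l₀ then (if ¬ I p l₀ ∧ I p₀ l then φ p l else 0) else 0) := by
        refine Finset.sum_congr rfl fun p₀ _ => ?_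
        split_ifs <;> simp
    _ = ∑ p, ∑ l, ∑ p₀, (if I p₀ l₀ then (if ¬ I p l₀ ∧ I p₀ l then φ p l else 0) else 0) := by
        rw [Finset.sum_comm]
        exact Finset.sum_congr rfl fun p _ => Finset.sum_comm
    _ = _ := by
        refine Finset.sum_congr rfl fun p _ => ?_
        simp only [h1]
        split_ifs <;> simp

end IsPlane

end A2Tilde

/-! ### Links of vertices are finite projective planes. -/

namespace A2Tilde

theorem exists_isPlane {P L : Type*} [Fintype P] [Fintype L] [Nonempty P] [Nonempty L] (I : P → L → Prop)
    (join : ∀ p p', p ≠ p' → ∃ l, I p l ∧ I p' l) (meet : ∀ l l', l ≠ l' → ∃ p, I p l ∧ I p l')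
    (unique : ∀ p p' l l', I p l → I p' l → I p l' → I p' l' → p = p' ∨ l = l')
    (points : ∀ l a b, ∃ p, I p l ∧ p ≠ a ∧ p ≠ b)
    (lines : ∀ p a b, ∃ l, I p l ∧ l ≠ a ∧ l ≠ b) : ∃ q, IsPlane I q := by
  classical
  let _ : Membership P L := ⟨fun l p => I p l⟩
  obtain ⟨p₂⟩ := ‹Nonempty P›
  obtain ⟨l₀⟩ := ‹Nonempty L›
  have hp : ∀ l, ∃ p, ¬ I p l := by
    intro l
    obtain ⟨p, hp, -⟩ := points l p₂ p₂
    obtain ⟨m, hm, hml, -⟩ := lines p l l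
    obtain ⟨p', hp', hne, -⟩ := points m p p
    exact ⟨p', fun hl => (unique p' p m l hp' hm hl hp).elim hne hml⟩
  have hl : ∀ p, ∃ l, ¬ I p l := by
    intro p
    obtain ⟨m, hm, -⟩ := lines p l₀ l₀
    obtain ⟨p', hp', hne, -⟩ := points m p p
    obtain ⟨l, hl, hne', -⟩ := lines p' m m
    exact ⟨l, fun hpl => (unique p' p m l hp' hm hl hpl).elim hne fun e => hne' e.symm⟩
  -- The nondegenerate configuration: three lines `l₂`, `l₃`, `m` through `p₂`, further points `p₃`
  -- on `l₂` and `p₁` on `m`, and a line `l₁` through `p₁` other than `m` and the join `n` of `p₁`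
  -- and `p₃`.
  obtain ⟨l₂, h22, -⟩ := lines p₂ l₀ l₀
  obtain ⟨l₃, h23, h32, -⟩ := lines p₂ l₂ l₂
  obtain ⟨m, h2m, hm2, hm3⟩ := lines p₂ l₂ l₃
  obtain ⟨p₃, h3, hp32, -⟩ := points l₂ p₂ p₂
  obtain ⟨p₁, h1, hp12, -⟩ := points m p₂ p₂
  have h12 : ¬ I p₁ l₂ := fun h => (unique p₁ p₂ m l₂ h1 h2m h h22).elim hp12 hm2
  have h13 : ¬ I p₁ l₃ := fun h => (unique p₁ p₂ m l₃ h1 h2m h h23).elim hp12 hm3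
  have h33 : ¬ I p₃ l₃ := fun h =>
    (unique p₃ p₂ l₂ l₃ h3 h22 h h23).elim hp32 fun e => h32 e.symm
  have hp13 : p₁ ≠ p₃ := fun e => h12 (e ▸ h3)
  obtain ⟨n, hn1, hn3⟩ := join p₁ p₃ hp13
  obtain ⟨l₁, h11, h1m, h1n⟩ := lines p₁ m n
  have h21 : ¬ I p₂ l₁ := fun h =>
    (unique p₁ p₂ m l₁ h1 h2m h11 h).elim hp12 fun e => h1m e.symm
  have h31 : ¬ I p₃ l₁ := fun h =>
    (unique p₁ p₃ n l₁ hn1 hn3 h11 h).elim hp13 fun e => h1n e.symm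
  let _ : Configuration.ProjectivePlane P L :=
    { exists_point := hp
      exists_line := hl
      eq_or_eq := fun {p p' l l'} => unique p p' l l'
      mkPoint := fun {l l'} h => (meet l l' h).choose
      mkPoint_ax := fun {l l'} h => (meet l l' h).choose_spec
      mkLine := fun {l l'} h => (join l l' h).choose
      mkLine_ax := fun {l l'} h => (join l l' h).choose_spec
      exists_config := ⟨p₁, p₂, p₃, l₁, l₂, l₃, h12, h13, h21, h22, h23, h31, h3, h33⟩ }
  refine ⟨Configuration.ProjectivePlane.order P L,
    Configuration.ProjectivePlane.one_lt_order P L,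
    fun p => Configuration.ProjectivePlane.lineCount_eq L p,
    fun l => Configuration.ProjectivePlane.pointCount_eq P l, ?_, ?_⟩
  · intro p p' h
    obtain ⟨l, hl, hl'⟩ := join p p' h
    exact ⟨l, ⟨hl, hl'⟩, fun m hm => ((unique p p' m l hm.1 hm.2 hl hl').resolve_left h)⟩
  · intro l l' h
    obtain ⟨p, hl, hl'⟩ := meet l l' h
    exact ⟨p, ⟨hl, hl'⟩, fun m hm => ((unique m p l l' hm.1 hl hm.2 hl').resolve_right h)⟩

/-- The six neighbours of the origin in the triangular lattice. -/
def hexagon : Finset (ℤ × ℤ) := {(1, 0), (0, 1), (-1, 1), (-1, 0), (0, -1), (1, -1)}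

theorem sub_mem_hexagon {x y : ℤ × ℤ} (h : {x, y} ∈ coxeterComplex.faces) (hxy : x ≠ y) :
    y - x ∈ hexagon := by
  obtain ⟨-, z, h | h⟩ := h <;>
  · have hx := h (Finset.mem_insert_self x {y})
    have hy := h (Finset.mem_insert_of_mem (Finset.mem_singleton_self y))
    simp only [upTriangle, downTriangle, Finset.mem_insert, Finset.mem_singleton] at hx hy
    rcases hx with rfl | rfl | rfl <;> rcases hy with rfl | rfl | rfl <;>
      first
      | exact absurd rfl hxy
      | (simp [hexagon, Prod.ext_iff])

theorem triangle_mem_faces (x : ℤ × ℤ) {u w : ℤ × ℤ} (hu : u ∈ hexagon) (hw : w ∈ hexagon)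
    (huw : u - w ∈ hexagon) : {x, x + u, x + w} ∈ coxeterComplex.faces := by
  -- A finite check at the origin, then translated by `x`.
  have key : ∀ u ∈ hexagon, ∀ w ∈ hexagon, u - w ∈ hexagon → ∃ z ∈ insert (0, 0) hexagon,
      ({(0, 0), u, w} : Finset (ℤ × ℤ)) ⊆ upTriangle z ∨
        ({(0, 0), u, w} : Finset (ℤ × ℤ)) ⊆ downTriangle z := by decide
  obtain ⟨z, -, hz⟩ := key u hu w hw huw
  refine ⟨by simp, x + z, hz.imp (fun h => ?_) (fun h => ?_)⟩ <;>
  · have h0 := h (show (0, 0) ∈ _ by simp)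
    have h1 := h (show u ∈ _ by simp)
    have h2 := h (show w ∈ _ by simp)
    simp only [upTriangle, downTriangle, Finset.mem_insert, Finset.mem_singleton] at h0 h1 h2
    intro y hy
    simp only [upTriangle, downTriangle, Finset.mem_insert, Finset.mem_singleton] at hy ⊢
    rcases hy with rfl | rfl | rfl
    · have : y = y + (0, 0) := by simp
      rcases h0 with h | h | h
      · left; rw [← h]; exact this
      · right; left; rw [add_assoc, ← h]; exact this
      · right; right; rw [add_assoc, ← h]; exact this
    all_goals simpa only [add_assoc, add_right_inj]

namespace IsApartmentSystem

variable {V : Type*} [DecidableEq V] {K : AbstractSimplicialComplex V} {𝒜 : Set (Set (Finset V))}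

theorem mem_of_subset (h : IsApartmentSystem K 𝒜) {A : Set (Finset V)} (hA : A ∈ 𝒜)
    {s t : Finset V} (hs : s ∈ A) (hts : t ⊆ s) (ht : t.Nonempty) : t ∈ A := by
  obtain ⟨f, rfl⟩ := h.exists_chart A hA
  obtain ⟨s, hs, rfl⟩ := hs
  obtain ⟨r, hr, rfl⟩ := Finset.subset_map_iff.1 hts
  exact ⟨r, (coxeterComplex.isRelLowerSet_faces hs).2 hr (by simpa using ht), rfl⟩

/-- Apartments are full subcomplexes. -/
theorem union_mem (h : IsApartmentSystem K 𝒜) {A : Set (Finset V)} (hA : A ∈ 𝒜)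
    {s t : Finset V} (hs : s ∈ A) (ht : t ∈ A) (hst : s ∪ t ∈ K.faces) : s ∪ t ∈ A := by
  obtain ⟨B, hB, hB', -⟩ := h.exists_common _ hst _ hst
  have hne : ∀ r ∈ A, r.Nonempty := fun r hr =>
    (K.isRelLowerSet_faces (h.subset_faces A hA hr)).1
  -- The isomorphism from `B` to `A` fixes `s` and `t` pointwise, so it carries the simplex `s ∪ t`
  -- of `B` to itself.
  obtain ⟨φ, -, hφ, hφs, hφt⟩ := h.exists_iso B hB A hA s t
    (h.mem_of_subset hB hB' Finset.subset_union_left (hne s hs))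
    (h.mem_of_subset hB hB' Finset.subset_union_right (hne t ht)) hs ht
  rw [← hφ]
  refine ⟨_, hB', ?_⟩
  show (s ∪ t).image φ = s ∪ t
  rw [Finset.image_union]
  congr 1
  · exact (Finset.image_congr (fun v hv => hφs v hv)).trans Finset.image_id
  · exact (Finset.image_congr (fun v hv => hφt v hv)).trans Finset.image_id

end IsApartmentSystem

namespace Building

variable {V : Type*} [DecidableEq V] (Δ : Building V)

theorem mem_faces_of_subset {s t : Finset V} (hs : s ∈ Δ.faces) (hts : t ⊆ s)
    (ht : t.Nonempty) : t ∈ Δ.faces :=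
  (Δ.isRelLowerSet_faces hs).2 hts ht

theorem typ_ne {s : Finset V} (hs : s ∈ Δ.faces) {v w : V} (hv : v ∈ s) (hw : w ∈ s)
    (h : v ≠ w) : Δ.typ v ≠ Δ.typ w :=
  fun e => h (Δ.typ_injOn s hs hv hw e)

/-- In an apartment containing both edges, the neighbours of `o` form a hexagon whose vertices
alternate between two types. Distinct vertices of equal type are therefore at distance two, and the
vertex between them is the join. -/
theorem exists_join {o p p' : V} (hp : {o, p} ∈ Δ.faces) (hp' : {o, p'} ∈ Δ.faces)
    (hne : p ≠ p') (ht : Δ.typ p = Δ.typ p') (ho : p ≠ o) (ho' : p' ≠ o) :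
    ∃ l, {o, p, l} ∈ Δ.faces ∧ {o, p', l} ∈ Δ.faces ∧ l ≠ o ∧ l ≠ p := by
  obtain ⟨𝒜, h⟩ := Δ.exists_apartmentSystem
  obtain ⟨A, hA, h1, h2⟩ := h.exists_common _ hp _ hp'
  have hsub := h.subset_faces A hA
  obtain ⟨f, rfl⟩ := h.exists_chart A hA
  have tri : ∀ (x u w : ℤ × ℤ), u ∈ hexagon → w ∈ hexagon → u - w ∈ hexagon →
      {f x, f (x + u), f (x + w)} ∈ Δ.faces := fun x u w hu hw huw =>
    hsub ⟨_, triangle_mem_faces x hu hw huw, by simp⟩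
  have pair : ∀ v, {o, v} ∈ {t | ∃ s ∈ coxeterComplex.faces, t = s.map f} → v ≠ o →
      ∃ x u, f x = o ∧ u ∈ hexagon ∧ f (x + u) = v := by
    rintro v ⟨s, hs, hsv⟩ hv
    have ho : o ∈ s.map f := hsv ▸ Finset.mem_insert_self _ _
    have hv' : v ∈ s.map f := hsv ▸ Finset.mem_insert_of_mem (Finset.mem_singleton_self _)
    obtain ⟨x, hx, rfl⟩ := Finset.mem_map.1 ho
    obtain ⟨y, hy, rfl⟩ := Finset.mem_map.1 hv'
    refine ⟨x, y - x, rfl, sub_mem_hexagon ?_ (fun e => hv (e ▸ rfl)), by simp⟩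
    refine (coxeterComplex.isRelLowerSet_faces hs).2 ?_ (by simp)
    intro z hz
    simp only [Finset.mem_insert, Finset.mem_singleton] at hz
    rcases hz with rfl | rfl <;> assumption
  obtain ⟨x, u, rfl, hu, rfl⟩ := pair p h1 ho
  obtain ⟨x', u', hx, hu', rfl⟩ := pair p' h2 ho'
  obtain rfl := f.injective hx
  have huu' : u ≠ u' := fun e => hne (e ▸ rfl)
  have nz : ∀ u ∈ hexagon, u ≠ 0 := by decide
  have symm : ∀ u w : ℤ × ℤ, u - w ∈ hexagon → w - u ∈ hexagon := by
    intro u w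
    have : ∀ d ∈ hexagon, -d ∈ hexagon := by decide
    intro h; simpa using this _ h
  have adj : ∀ u w, u ∈ hexagon → w ∈ hexagon → u - w ∈ hexagon →
      Δ.typ (f (x' + u)) ≠ Δ.typ (f (x' + w)) := by
    intro u w hu hw huw
    refine Δ.typ_ne (tri x' u w hu hw huw) (by simp) (by simp) fun e => nz _ huw ?_
    simpa [sub_eq_zero] using f.injective e
  have adj0 : ∀ u, u ∈ hexagon → Δ.typ (f (x' + u)) ≠ Δ.typ (f x') := by
    intro u hu
    have : ∀ u ∈ hexagon, ∃ w ∈ hexagon, u - w ∈ hexagon := by decide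
    obtain ⟨w, hw, huw⟩ := this u hu
    refine Δ.typ_ne (tri x' u w hu hw huw) (by simp) (by simp) fun e => nz _ hu ?_
    simpa using f.injective e
  have key : ∀ u ∈ hexagon, ∀ u' ∈ hexagon, u = u' ∨ u - u' ∈ hexagon ∨
      (∃ w ∈ hexagon, u - w ∈ hexagon ∧ u' - w ∈ hexagon) ∨
      (∃ w ∈ hexagon, ∃ w' ∈ hexagon, u - w ∈ hexagon ∧ w - w' ∈ hexagon ∧
        w' - u' ∈ hexagon) := by decide
  rcases key u hu u' hu' with e | e | ⟨w, hw, h1, h2⟩ | ⟨w, hw, w', hw', h1, h2, h3⟩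
  · exact absurd e huu'
  · exact absurd ht (adj u u' hu hu' e)
  · refine ⟨f (x' + w), tri _ _ _ hu hw h1, tri _ _ _ hu' hw h2, fun e => ?_, fun e => ?_⟩
    · exact adj0 w hw (congrArg Δ.typ e)
    · exact adj u w hu hw h1 (congrArg Δ.typ e.symm)
  · exfalso
    -- Opposite vertices of the hexagon: three steps alternating between the two types other than
    -- that of `o` end at the other type.
    have three : ∀ o a b c d : ZMod 3, a ≠ b → b ≠ c → c ≠ d → a ≠ o → b ≠ o → c ≠ o → d ≠ o →
        a ≠ d := by decide
    exact three _ _ _ _ _ (adj _ _ hu hw h1) (adj _ _ hw hw' h2) (adj _ _ hw' hu' h3)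
      (adj0 _ hu) (adj0 _ hw) (adj0 _ hw') (adj0 _ hu') ht

/-- An apartment containing the chambers `{o, p, l}` and `{o, p', l'}` contains all the edges
involved, since it is a full subcomplex. If both equalities failed, there would be a 4-cycle in the
hexagon around `o`. -/
theorem join_unique {o p p' l l' : V} (h₁ : {o, p, l} ∈ Δ.faces) (h₂ : {o, p', l} ∈ Δ.faces)
    (h₃ : {o, p, l'} ∈ Δ.faces) (h₄ : {o, p', l'} ∈ Δ.faces) (hpo : p ≠ o) (hpo' : p' ≠ o)
    (hlo : l ≠ o) (hlo' : l' ≠ o) (hpl : p ≠ l) (hpl₂ : p' ≠ l) (hpl₃ : p ≠ l')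
    (hpl₄ : p' ≠ l') : p = p' ∨ l = l' := by
  obtain ⟨𝒜, h⟩ := Δ.exists_apartmentSystem
  obtain ⟨A, hA, hA1, hA2⟩ := h.exists_common _ h₁ _ h₄
  have vert : ∀ v, (v = o ∨ v = p ∨ v = l ∨ v = p' ∨ v = l') → {v} ∈ A := by
    rintro v (rfl | rfl | rfl | rfl | rfl)
    · exact h.mem_of_subset hA hA1 (by simp) (by simp)
    · exact h.mem_of_subset hA hA1 (by simp) (by simp)
    · exact h.mem_of_subset hA hA1 (by simp) (by simp)
    · exact h.mem_of_subset hA hA2 (by simp) (by simp)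
    · exact h.mem_of_subset hA hA2 (by simp) (by simp)
  have edge : ∀ v w s, {v} ∈ A → {w} ∈ A → s ∈ Δ.faces → v ∈ s → w ∈ s → {v, w} ∈ A := by
    intro v w s hv hw hs hvs hws
    refine h.union_mem hA hv hw (Δ.mem_faces_of_subset hs ?_ (by simp))
    intro y hy
    simp only [Finset.mem_union, Finset.mem_singleton] at hy
    rcases hy with rfl | rfl <;> assumption
  obtain ⟨f, rfl⟩ := h.exists_chart A hA
  have lift : ∀ v, {v} ∈ {t | ∃ s ∈ coxeterComplex.faces, t = s.map f} → ∃ x, f x = v := by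
    rintro v ⟨s, -, hs⟩
    obtain ⟨x, -, hx⟩ := Finset.mem_map.1 (hs ▸ Finset.mem_singleton_self v)
    exact ⟨x, hx⟩
  have hex : ∀ x y, {f x, f y} ∈ {t | ∃ s ∈ coxeterComplex.faces, t = s.map f} → f x ≠ f y →
      y - x ∈ hexagon := by
    rintro x y ⟨s, hs, hxy⟩ hne
    refine sub_mem_hexagon ?_ (fun e => hne (e ▸ rfl))
    rwa [show ({x, y} : Finset (ℤ × ℤ)) = s from Finset.map_injective f (by simpa using hxy)]
  have e1 := edge p l _ (vert _ (by simp)) (vert _ (by simp)) h₁ (by simp) (by simp)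
  have e2 := edge p' l _ (vert _ (by simp)) (vert _ (by simp)) h₂ (by simp) (by simp)
  have e3 := edge p l' _ (vert _ (by simp)) (vert _ (by simp)) h₃ (by simp) (by simp)
  have e4 := edge p' l' _ (vert _ (by simp)) (vert _ (by simp)) h₄ (by simp) (by simp)
  have e5 := edge o p _ (vert _ (by simp)) (vert _ (by simp)) h₁ (by simp) (by simp)
  have e6 := edge o p' _ (vert _ (by simp)) (vert _ (by simp)) h₂ (by simp) (by simp)
  have e7 := edge o l _ (vert _ (by simp)) (vert _ (by simp)) h₁ (by simp) (by simp)
  have e8 := edge o l' _ (vert _ (by simp)) (vert _ (by simp)) h₃ (by simp) (by simp)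
  obtain ⟨x, rfl⟩ := lift o (vert _ (by simp))
  obtain ⟨a, rfl⟩ := lift p (vert _ (by simp))
  obtain ⟨a', rfl⟩ := lift p' (vert _ (by simp))
  obtain ⟨b, rfl⟩ := lift l (vert _ (by simp))
  obtain ⟨b', rfl⟩ := lift l' (vert _ (by simp))
  have key : ∀ u ∈ hexagon, ∀ w ∈ hexagon, w - u ∈ hexagon → ∀ u' ∈ hexagon, w - u' ∈ hexagon →
      ∀ w' ∈ hexagon, w' - u ∈ hexagon → w' - u' ∈ hexagon → u = u' ∨ w = w' := by decide
  have := key (a - x) (hex _ _ e5 hpo.symm) (b - x) (hex _ _ e7 hlo.symm)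
    (by simpa using hex _ _ e1 hpl) (a' - x) (hex _ _ e6 hpo'.symm)
    (by simpa using hex _ _ e2 hpl₂) (b' - x) (hex _ _ e8 hlo'.symm)
    (by simpa using hex _ _ e3 hpl₃) (by simpa using hex _ _ e4 hpl₄)
  simpa using this

theorem exists_third {o v : V} (h : {o, v} ∈ Δ.faces) (hne : v ≠ o) (a b : V) :
    ∃ w, {o, v, w} ∈ Δ.faces ∧ w ≠ o ∧ w ≠ v ∧ w ≠ a ∧ w ≠ b := by
  by_contra! hcon
  have h3 := Δ.thick _ h (Finset.card_pair hne.symm)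
  -- Otherwise only `a` and `b` could complete the edge to a chamber, giving at most two chambers
  -- against thickness.
  have hsub : {s ∈ Δ.faces | {o, v} ⊆ s ∧ s.card = 3} ⊆ {{o, v, a}, {o, v, b}} := by
    rintro s ⟨hs, hov, hs3⟩
    have ho : o ∈ s := hov (by simp)
    have hv : v ∈ s := hov (by simp)
    obtain ⟨w, hws, hw⟩ : ∃ w ∈ s, w ∉ ({o, v} : Finset V) :=
      Finset.exists_mem_notMem_of_card_lt_card (by rw [Finset.card_pair hne.symm, hs3]; simp)
    simp only [Finset.mem_insert, Finset.mem_singleton, not_or] at hw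
    have hsw : s = {o, v, w} := by
      refine (Finset.eq_of_subset_of_card_le ?_ ?_).symm
      · intro y hy
        simp only [Finset.mem_insert, Finset.mem_singleton] at hy
        rcases hy with rfl | rfl | rfl <;> assumption
      · rw [hs3, Finset.card_eq_three.2 ⟨o, v, w, hne.symm, Ne.symm hw.1, Ne.symm hw.2, rfl⟩]
    subst hsw
    by_cases hwa : w = a
    · left; rw [hwa]
    · right; rw [hcon w hs hw.1 hw.2 hwa]; rfl
  have := (h3.trans (Set.encard_le_encard hsub)).trans ((Set.encard_insert_le _ _).trans
    (by rw [Set.encard_singleton]))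
  exact absurd this (by decide)

/-- The points of the link of the vertex `o`: its neighbours of type one more. -/
def Point (o : V) : Type _ := {v // {o, v} ∈ Δ.faces ∧ Δ.typ v = Δ.typ o + 1}

/-- The lines of the link of the vertex `o`: its neighbours of type two more. -/
def Line (o : V) : Type _ := {v // {o, v} ∈ Δ.faces ∧ Δ.typ v = Δ.typ o + 2}

variable {Δ} in
/-- Incidence in the link of the vertex `o`. -/
def Incident {o : V} (p : Δ.Point o) (l : Δ.Line o) : Prop := {o, p.1, l.1} ∈ Δ.faces

theorem finite_neighbours (o : V) : {v | {o, v} ∈ Δ.faces}.Finite := by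
  refine ((Δ.locallyFinite o).biUnion fun s _ => s.finite_toSet).subset fun v hv => ?_
  exact Set.mem_biUnion (show {o, v} ∈ {s ∈ Δ.faces | o ∈ s} from ⟨hv, by simp⟩) (by simp)

instance (o : V) : Finite (Δ.Point o) :=
  ((Δ.finite_neighbours o).subset fun _ h => h.1 : {v | _ ∧ Δ.typ v = Δ.typ o + 1}.Finite)

instance (o : V) : Finite (Δ.Line o) :=
  ((Δ.finite_neighbours o).subset fun _ h => h.1 : {v | _ ∧ Δ.typ v = Δ.typ o + 2}.Finite)

noncomputable instance (o : V) : Fintype (Δ.Point o) := Fintype.ofFinite _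

noncomputable instance (o : V) : Fintype (Δ.Line o) := Fintype.ofFinite _

theorem Point.ne {o : V} (p : Δ.Point o) : p.1 ≠ o := fun e =>
  (by decide : ∀ a : ZMod 3, a ≠ a + 1) _ (by rw [← p.2.2, e])

theorem Line.ne {o : V} (l : Δ.Line o) : l.1 ≠ o := fun e =>
  (by decide : ∀ a : ZMod 3, a ≠ a + 2) _ (by rw [← l.2.2, e])

theorem Point.ne_line {o : V} (p : Δ.Point o) (l : Δ.Line o) : p.1 ≠ l.1 := fun e =>
  (by decide : ∀ a : ZMod 3, a + 1 ≠ a + 2) _ (by rw [← p.2.2, ← l.2.2, e])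

theorem exists_line_of_mem_faces {o : V} (p : Δ.Point o) {w : V} (hw : {o, p.1, w} ∈ Δ.faces)
    (h₁ : w ≠ o) (h₂ : w ≠ p.1) : ∃ l : Δ.Line o, l.1 = w := by
  refine ⟨⟨w, Δ.mem_faces_of_subset hw (by intro y; simp; tauto) (by simp), ?_⟩, rfl⟩
  have e1 := Δ.typ_ne hw (v := w) (w := o) (by simp) (by simp) h₁
  have e2 := Δ.typ_ne hw (v := w) (w := p.1) (by simp) (by simp) h₂
  rw [p.2.2] at e2
  exact (by decide : ∀ a b : ZMod 3, b ≠ a → b ≠ a + 1 → b = a + 2) _ _ e1 e2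

theorem exists_point_of_mem_faces {o : V} (l : Δ.Line o) {w : V} (hw : {o, l.1, w} ∈ Δ.faces)
    (h₁ : w ≠ o) (h₂ : w ≠ l.1) : ∃ p : Δ.Point o, p.1 = w := by
  refine ⟨⟨w, Δ.mem_faces_of_subset hw (by intro y; simp; tauto) (by simp), ?_⟩, rfl⟩
  have e1 := Δ.typ_ne hw (v := w) (w := o) (by simp) (by simp) h₁
  have e2 := Δ.typ_ne hw (v := w) (w := l.1) (by simp) (by simp) h₂
  rw [l.2.2] at e2
  exact (by decide : ∀ a b : ZMod 3, b ≠ a → b ≠ a + 2 → b = a + 1) _ _ e1 e2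

theorem exists_point (o : V) : Nonempty (Δ.Point o) := by
  obtain ⟨𝒜, h⟩ := Δ.exists_apartmentSystem
  obtain ⟨A, hA, ho, -⟩ := h.exists_common _ (Δ.singleton_mem o) _ (Δ.singleton_mem o)
  have hsub := h.subset_faces A hA
  obtain ⟨f, rfl⟩ := h.exists_chart A hA
  obtain ⟨s, -, hs⟩ := ho
  obtain ⟨x, -, rfl⟩ := Finset.mem_map.1 (hs ▸ Finset.mem_singleton_self o)
  have hf : {f x, f (x + (1, 0)), f (x + (0, 1))} ∈ Δ.faces :=
    hsub ⟨{x, x + (1, 0), x + (0, 1)}, triangle_mem_faces x (by decide) (by decide) (by decide),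
      by simp⟩
  have e1 := Δ.typ_ne hf (v := f (x + (1, 0))) (w := f x) (by simp) (by simp)
    (fun e => by simpa using f.injective e)
  have e2 := Δ.typ_ne hf (v := f (x + (0, 1))) (w := f x) (by simp) (by simp)
    (fun e => by simpa using f.injective e)
  have e3 := Δ.typ_ne hf (v := f (x + (1, 0))) (w := f (x + (0, 1))) (by simp) (by simp)
    (fun e => by simpa using f.injective e)
  rcases (by decide : ∀ a b c : ZMod 3, b ≠ a → c ≠ a → b ≠ c → b = a + 1 ∨ c = a + 1) _ _ _
    e1 e2 e3 with e | e
  · exact ⟨⟨_, Δ.mem_faces_of_subset hf (by intro y; simp; tauto) (by simp), e⟩⟩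
  · exact ⟨⟨_, Δ.mem_faces_of_subset hf (by intro y; simp; tauto) (by simp), e⟩⟩

theorem insert_comm {a b c : V} : ({a, b, c} : Finset V) = {a, c, b} := by
  ext; simp; tauto

/-- The link of a vertex is a finite projective plane. -/
theorem exists_isPlane_incident (o : V) : ∃ q, IsPlane (Incident (Δ := Δ) (o := o)) q := by
  have hP := Δ.exists_point o
  have hL : Nonempty (Δ.Line o) := by
    obtain ⟨p⟩ := hP
    obtain ⟨w, h1, h2, h3, -⟩ := Δ.exists_third p.2.1 p.ne o o
    exact ⟨(Δ.exists_line_of_mem_faces p h1 h2 h3).choose⟩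
  refine exists_isPlane _ ?_ ?_ ?_ ?_ ?_
  · intro p p' hne
    obtain ⟨w, h1, h2, h3, h4⟩ := Δ.exists_join p.2.1 p'.2.1 (fun e => hne (Subtype.ext e))
      (p.2.2.trans p'.2.2.symm) p.ne p'.ne
    obtain ⟨l, rfl⟩ := Δ.exists_line_of_mem_faces p h1 h3 h4
    exact ⟨l, h1, h2⟩
  · intro l l' hne
    obtain ⟨w, h1, h2, h3, h4⟩ := Δ.exists_join l.2.1 l'.2.1 (fun e => hne (Subtype.ext e))
      (l.2.2.trans l'.2.2.symm) l.ne l'.ne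
    obtain ⟨p, rfl⟩ := Δ.exists_point_of_mem_faces l h1 h3 h4
    exact ⟨p, by rwa [Incident, insert_comm], by rwa [Incident, insert_comm]⟩
  · intro p p' l l' h1 h2 h3 h4
    exact (Δ.join_unique h1 h2 h3 h4 p.ne p'.ne l.ne l'.ne (p.ne_line _ _) (p'.ne_line _ _)
      (p.ne_line _ _) (p'.ne_line _ _)).imp (fun e => Subtype.ext e) (fun e => Subtype.ext e)
  · intro l a b
    obtain ⟨w, h1, h2, h3, h4, h5⟩ := Δ.exists_third l.2.1 l.ne a.1 b.1
    obtain ⟨p, rfl⟩ := Δ.exists_point_of_mem_faces l h1 h2 h3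
    exact ⟨p, by rwa [Incident, insert_comm], fun e => h4 (e ▸ rfl), fun e => h5 (e ▸ rfl)⟩
  · intro p a b
    obtain ⟨w, h1, h2, h3, h4, h5⟩ := Δ.exists_third p.2.1 p.ne a.1 b.1
    obtain ⟨l, rfl⟩ := Δ.exists_line_of_mem_faces p h1 h2 h3
    exact ⟨l, h1, fun e => h4 (e ▸ rfl), fun e => h5 (e ▸ rfl)⟩

end Building

end A2Tilde

/-! ### Directed cells and edge labels read in the link of one vertex. -/

noncomputable section

namespace A2Tilde

open Building

variable {V : Type*} [DecidableEq V] {Δ : Building V} {Γ : Type*} [Group Γ] [MulAction Γ V]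

namespace IsA2TildeGroup

theorem eq_of_smul_eq (hΓ : IsA2TildeGroup Δ Γ) {g g' : Γ} {v : V} (h : g • v = g' • v) :
    g = g' := by
  have := hΓ.free (g'⁻¹ * g) v (by rw [mul_smul, h, inv_smul_smul])
  rwa [inv_mul_eq_one, eq_comm] at this

theorem smul_faces_iff (hΓ : IsA2TildeGroup Δ Γ) (g : Γ) (a b c : V) :
    {g • a, g • b, g • c} ∈ Δ.faces ↔ {a, b, c} ∈ Δ.faces := by
  constructor
  · intro h
    simpa [Finset.image_insert] using hΓ.smul_mem_faces g⁻¹ _ h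
  · intro h
    simpa [Finset.image_insert] using hΓ.smul_mem_faces g _ h

theorem smul_edge_mem (hΓ : IsA2TildeGroup Δ Γ) (g : Γ) {a b : V} (h : {a, b} ∈ Δ.faces) :
    {g • a, g • b} ∈ Δ.faces := by
  simpa [Finset.image_insert] using hΓ.smul_mem_faces g _ h

theorem typ_smul (hΓ : IsA2TildeGroup Δ Γ) (g : Γ) {a b : V} {i : ZMod 3}
    (h : Δ.typ b = Δ.typ a + i) : Δ.typ (g • b) = Δ.typ (g • a) + i := by
  obtain ⟨j, hj⟩ := hΓ.typeRotating g
  rw [hj, hj, h]; ring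

-- An entry asks for some pair of representatives in the right position. Any such pair is carried to
-- `(x, y)` by two group elements agreeing at the common vertex, which freeness forces to be equal;
-- so the position can be tested on `(x, y)` itself.
open Classical in
theorem transM_mk (hΓ : IsA2TildeGroup Δ Γ) {x y : Chamber Δ} (h : y.base = x.right) :
    transM Δ Γ (Quotient.mk (chamberSetoid Δ Γ) x) (Quotient.mk (chamberSetoid Δ Γ) y) =
      if x.PosM y then 1 else 0 := by
  unfold transM
  congr 1
  refine propext ⟨?_, fun hp => ⟨x, y, rfl, rfl, hp⟩⟩
  rintro ⟨x', y', hx, hy, h₁, h₂, h₃⟩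
  obtain ⟨g, a₁, a₂, a₃⟩ := Quotient.exact hx
  obtain ⟨g', b₁, b₂, b₃⟩ := Quotient.exact hy
  obtain rfl : g = g' := hΓ.eq_of_smul_eq (v := x'.right) (by rw [a₂, ← h₁, b₁, h])
  refine ⟨h, ?_, ?_⟩
  · rwa [← a₂, ← a₁, ← b₂, hΓ.smul_faces_iff]
  · rwa [← a₂, ← a₃, ← b₃, hΓ.smul_faces_iff]

open Classical in
theorem transN_mk (hΓ : IsA2TildeGroup Δ Γ) {x y : Chamber Δ} (h : y.base = x.left) :
    transN Δ Γ (Quotient.mk (chamberSetoid Δ Γ) x) (Quotient.mk (chamberSetoid Δ Γ) y) =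
      if x.PosN y then 1 else 0 := by
  unfold transN
  congr 1
  refine propext ⟨?_, fun hp => ⟨x, y, rfl, rfl, hp⟩⟩
  rintro ⟨x', y', hx, hy, h₁, h₂, h₃⟩
  obtain ⟨g, a₁, a₂, a₃⟩ := Quotient.exact hx
  obtain ⟨g', b₁, b₂, b₃⟩ := Quotient.exact hy
  obtain rfl : g = g' := hΓ.eq_of_smul_eq (v := x'.left) (by rw [a₃, ← h₁, b₁, h])
  refine ⟨h, ?_, ?_⟩
  · rwa [← a₃, ← a₁, ← b₃, hΓ.smul_faces_iff]
  · rwa [← a₃, ← a₂, ← b₂, hΓ.smul_faces_iff]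

end IsA2TildeGroup

namespace DirectedCell

theorem rotate_rotate_rotate (a : DirectedCell Δ Γ) : a.rotate.rotate.rotate = a := by
  induction a using Quotient.inductionOn; rfl

theorem edge₁_rotate (a : DirectedCell Δ Γ) : a.rotate.edge₁ = a.edge₂ := by
  induction a using Quotient.inductionOn; rfl

theorem edge₂_rotate_rotate (a : DirectedCell Δ Γ) : a.rotate.rotate.edge₂ = a.edge₁ := by
  induction a using Quotient.inductionOn; rfl

theorem rotate_bijective : Function.Bijective (rotate : DirectedCell Δ Γ → DirectedCell Δ Γ) :=
  Function.bijective_iff_has_inverse.2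
    ⟨fun a => a.rotate.rotate, rotate_rotate_rotate, rotate_rotate_rotate⟩

end DirectedCell

variable (Γ) in
/-- The directed 2-cell of a flag in the link of the vertex `o`. -/
def flagCell {o : V} (p : Δ.Point o) (l : Δ.Line o) (h : Incident p l) : DirectedCell Δ Γ :=
  Quotient.mk (chamberSetoid Δ Γ) ⟨o, p.1, l.1, h, p.2.2, l.2.2⟩

variable (Γ) in
/-- The label of the directed edge from `o` to a point of its link. -/
def pointLabel {o : V} (p : Δ.Point o) : EdgeLabel Δ Γ :=
  Quotient.mk (edgeSetoid Δ Γ) ⟨o, p.1, p.2.1, p.2.2⟩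

variable (Γ) in
/-- The label of the directed edge from a line of the link of `o` to `o`. -/
def lineLabel {o : V} (l : Δ.Line o) : EdgeLabel Δ Γ :=
  Quotient.mk (edgeSetoid Δ Γ) ⟨l.1, o, Finset.pair_comm o l.1 ▸ l.2.1, by
    rw [l.2.2, add_assoc, show (2 + 1 : ZMod 3) = 0 from rfl, add_zero]⟩

section Labels

variable (hΓ : IsA2TildeGroup Δ Γ) (o : V)
include hΓ

/-- Transitivity moves the initial vertex of any directed edge to `o`, and freeness makes the
translate unique. The next two bijections rest on the same argument. -/
theorem pointLabel_bijective :
    Function.Bijective (pointLabel Γ : Δ.Point o → EdgeLabel Δ Γ) := by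
  constructor
  · intro p p' h
    obtain ⟨g, h₁, h₂⟩ := Quotient.exact h
    obtain rfl := hΓ.free g o h₁
    exact Subtype.ext ((one_smul Γ p.1).symm.trans h₂)
  · intro ξ
    induction ξ using Quotient.inductionOn with | h e
    obtain ⟨g, hg⟩ := hΓ.transitive e.src o
    refine ⟨⟨g • e.tgt, hg ▸ hΓ.smul_edge_mem g e.mem_faces, hg ▸ hΓ.typ_smul g e.typ_tgt⟩, ?_⟩
    exact Quotient.sound ⟨g⁻¹, inv_smul_eq_iff.2 hg.symm, inv_smul_smul _ _⟩

theorem lineLabel_bijective :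
    Function.Bijective (lineLabel Γ : Δ.Line o → EdgeLabel Δ Γ) := by
  constructor
  · intro l l' h
    obtain ⟨g, h₁, h₂⟩ := Quotient.exact h
    obtain rfl := hΓ.free g o h₂
    exact Subtype.ext ((one_smul Γ l.1).symm.trans h₁)
  · intro ξ
    induction ξ using Quotient.inductionOn with | h e
    obtain ⟨g, hg⟩ := hΓ.transitive e.tgt o
    have ht : Δ.typ e.src = Δ.typ e.tgt + 2 := by
      rw [e.typ_tgt, add_assoc, show (1 + 2 : ZMod 3) = 0 from rfl, add_zero]
    refine ⟨⟨g • e.src, ?_, hg ▸ hΓ.typ_smul g ht⟩, ?_⟩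
    · rw [Finset.pair_comm]; exact hg ▸ hΓ.smul_edge_mem g e.mem_faces
    · exact Quotient.sound ⟨g⁻¹, inv_smul_smul _ _, inv_smul_eq_iff.2 hg.symm⟩

theorem flagCell_bijective : Function.Bijective
    (fun x : {x : Δ.Point o × Δ.Line o // Incident x.1 x.2} => flagCell Γ x.1.1 x.1.2 x.2) := by
  constructor
  · rintro ⟨⟨p, l⟩, h⟩ ⟨⟨p', l'⟩, h'⟩ e
    obtain ⟨g, h₁, h₂, h₃⟩ := Quotient.exact e
    obtain rfl := hΓ.free g o h₁
    obtain rfl : p = p' := Subtype.ext ((one_smul Γ p.1).symm.trans h₂)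
    obtain rfl : l = l' := Subtype.ext ((one_smul Γ l.1).symm.trans h₃)
    rfl
  · intro a
    induction a using Quotient.inductionOn with | h x
    obtain ⟨g, hg⟩ := hΓ.transitive x.base o
    have hm := (hΓ.smul_faces_iff g _ _ _).2 x.mem_faces
    rw [hg] at hm
    refine ⟨⟨⟨⟨g • x.right, ?_, hg ▸ hΓ.typ_smul g x.typ_right⟩,
      ⟨g • x.left, ?_, hg ▸ hΓ.typ_smul g x.typ_left⟩⟩, hm⟩, ?_⟩
    · exact Δ.mem_faces_of_subset hm (by intro y; simp; tauto) (by simp)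
    · exact Δ.mem_faces_of_subset hm (by intro y; simp; tauto) (by simp)
    · exact Quotient.sound ⟨g⁻¹, inv_smul_eq_iff.2 hg.symm, inv_smul_smul _ _,
        inv_smul_smul _ _⟩

theorem exists_flagCell_eq (a : DirectedCell Δ Γ) :
    ∃ (p : Δ.Point o) (l : Δ.Line o) (h : Incident p l), flagCell Γ p l h = a := by
  obtain ⟨⟨⟨p, l⟩, h⟩, e⟩ := (flagCell_bijective hΓ o).2 a
  exact ⟨p, l, h, e⟩

variable [Fintype (DirectedCell Δ Γ)]

open Classical in
theorem sum_directedCell (G : DirectedCell Δ Γ → ℝ) : ∑ a, G a =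
    ∑ p : Δ.Point o, ∑ l : Δ.Line o, if h : Incident p l then G (flagCell Γ p l h) else 0 := by
  let G' : Δ.Point o × Δ.Line o → ℝ := fun y =>
    if h : Incident y.1 y.2 then G (flagCell Γ y.1 y.2 h) else 0
  rw [← (flagCell_bijective hΓ o).sum_comp, ← Fintype.sum_prod_type' (f := fun p l => G' (p, l))]
  rw [← Finset.sum_filter_of_ne (p := fun y : Δ.Point o × Δ.Line o => Incident y.1 y.2)
    (fun y _ hy => by by_contra hn; exact hy (dif_neg hn)),
    Finset.sum_subtype (p := fun y : Δ.Point o × Δ.Line o => Incident y.1 y.2) _ (by simp)]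
  exact Finset.sum_congr rfl fun x _ => (show G' x.1 = _ from dif_pos x.2).symm

end Labels

open Classical in
/-- A function on directed 2-cells, as a function on the flags in the link of `o`. -/
def linkFun (f : DirectedCell Δ Γ → ℝ) (o : V) (p : Δ.Point o) (l : Δ.Line o) : ℝ :=
  if h : Incident p l then f (flagCell Γ p l h) else 0

theorem linkFun_of_incident (f : DirectedCell Δ Γ → ℝ) {o : V} {p : Δ.Point o} {l : Δ.Line o}
    (h : Incident p l) : linkFun f o p l = f (flagCell Γ p l h) :=
  dif_pos h

theorem linkFun_of_not_incident (f : DirectedCell Δ Γ → ℝ) {o : V} (p : Δ.Point o)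
    (l : Δ.Line o) (h : ¬ Incident p l) : linkFun f o p l = 0 :=
  dif_neg h

/-! ### The transition equations in the link. -/

section Transfer

variable (hΓ : IsA2TildeGroup Δ Γ) {o : V} [Fintype (DirectedCell Δ Γ)]
  (f : DirectedCell Δ Γ → ℝ)
include hΓ

open Classical in
theorem sum_edge₂_eq (G : DirectedCell Δ Γ → ℝ) (p : Δ.Point o) :
    (∑ a : DirectedCell Δ Γ, if a.edge₂ = pointLabel Γ p then G a else 0) =
      ∑ l, linkFun G o p l := by
  rw [sum_directedCell hΓ o, Finset.sum_eq_single p]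
  · refine Finset.sum_congr rfl fun l _ => ?_
    unfold linkFun
    split_ifs with h h'
    · rfl
    · exact absurd rfl h'
    · rfl
  · intro p' _ hne
    refine Finset.sum_eq_zero fun l _ => ?_
    split_ifs with h h'
    · exact absurd ((pointLabel_bijective hΓ o).1 h') hne
    · rfl
    · rfl
  · simp

open Classical in
theorem sum_edge₁_eq (G : DirectedCell Δ Γ → ℝ) (l : Δ.Line o) :
    (∑ a : DirectedCell Δ Γ, if a.edge₁ = lineLabel Γ l then G a else 0) =
      ∑ p, linkFun G o p l := by
  rw [sum_directedCell hΓ o]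
  refine Finset.sum_congr rfl fun p _ => ?_
  rw [Finset.sum_eq_single l]
  · unfold linkFun
    split_ifs with h h'
    · rfl
    · exact absurd rfl h'
    · rfl
  · intro l' _ hne
    split_ifs with h h'
    · exact absurd ((lineLabel_bijective hΓ o).1 h') hne
    · rfl
    · rfl
  · simp

-- Rotating twice makes `o` the right vertex of the cell, which is where the successors under
-- `transM` are based. For `transN` one rotation makes `o` the left vertex.
open Classical in
theorem sum_transM (p₀ : Δ.Point o) (l₀ : Δ.Line o) (h₀ : Incident p₀ l₀) :
    ∑ b, (transM Δ Γ (flagCell Γ p₀ l₀ h₀).rotate.rotate b : ℝ) * f b =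
      ∑ p, ∑ l, if ¬ Incident p l₀ ∧ Incident p₀ l then linkFun f o p l else 0 := by
  rw [sum_directedCell hΓ o]
  refine Finset.sum_congr rfl fun p _ => Finset.sum_congr rfl fun l _ => ?_
  unfold linkFun
  split_ifs with h h' h'
  · have : transM Δ Γ (flagCell Γ p₀ l₀ h₀).rotate.rotate (flagCell Γ p l h) = 1 := by
      refine (hΓ.transM_mk rfl).trans (if_pos ⟨rfl, ?_, h'.2⟩)
      show {o, l₀.1, p.1} ∉ Δ.faces
      rw [insert_comm]; exact h'.1
    rw [this]; simp
  · have : transM Δ Γ (flagCell Γ p₀ l₀ h₀).rotate.rotate (flagCell Γ p l h) = 0 := by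
      refine (hΓ.transM_mk rfl).trans (if_neg fun hp => h' ⟨fun hi => hp.2.1 ?_, hp.2.2⟩)
      show {o, l₀.1, p.1} ∈ Δ.faces
      rw [insert_comm]; exact hi
    rw [this]; simp
  · rfl
  · rfl

open Classical in
theorem sum_transN (p₀ : Δ.Point o) (l₀ : Δ.Line o) (h₀ : Incident p₀ l₀) :
    ∑ b, (transN Δ Γ (flagCell Γ p₀ l₀ h₀).rotate b : ℝ) * f b =
      ∑ l, ∑ p, if ¬ Incident p₀ l ∧ Incident p l₀ then linkFun f o p l else 0 := by
  rw [sum_directedCell hΓ o, Finset.sum_comm]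
  refine Finset.sum_congr rfl fun l _ => Finset.sum_congr rfl fun p _ => ?_
  unfold linkFun
  split_ifs with h h' h'
  · have : transN Δ Γ (flagCell Γ p₀ l₀ h₀).rotate (flagCell Γ p l h) = 1 := by
      refine (hΓ.transN_mk rfl).trans (if_pos ⟨rfl, h'.1, ?_⟩)
      show {o, l₀.1, p.1} ∈ Δ.faces
      rw [insert_comm]; exact h'.2
    rw [this]; simp
  · have : transN Δ Γ (flagCell Γ p₀ l₀ h₀).rotate (flagCell Γ p l h) = 0 := by
      refine (hΓ.transN_mk rfl).trans (if_neg fun hp => h' ⟨hp.2.1, ?_⟩)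
      have h3 : {o, l₀.1, p.1} ∈ Δ.faces := hp.2.2
      rwa [insert_comm] at h3
    rw [this]; simp
  · rfl
  · rfl

open Classical in
/-- The real valued solutions of the transition equations are those of the relations of
`C₀(Γ)`. -/
theorem transition_iff :
    ((∀ a, f a = ∑ b, (transM Δ Γ a b : ℝ) * f b) ∧
      (∀ a, f a = ∑ b, (transN Δ Γ a b : ℝ) * f b)) ↔
    ((∀ a, f a = f a.rotate) ∧
      (∀ ξ : EdgeLabel Δ Γ, (∑ a : DirectedCell Δ Γ, if a.edge₂ = ξ then f a else 0) = 0) ∧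
      (∀ ξ : EdgeLabel Δ Γ, (∑ a : DirectedCell Δ Γ, if a.edge₁ = ξ then f a else 0) = 0)) := by
  obtain ⟨o⟩ := Δ.nonempty
  obtain ⟨q, hq⟩ := Δ.exists_isPlane_incident o
  have hP := pointLabel_bijective hΓ o
  have hL := lineLabel_bijective hΓ o
  have h0 := linkFun_of_not_incident f (o := o)
  constructor
  · rintro ⟨hM, hN⟩
    have hF : ∀ p, ∑ l, linkFun f o p l = 0 := by
      let e₁ := Equiv.ofBijective _ hL
      let e₂ := Equiv.ofBijective _ hP
      -- Here `σ` sends a line `l₀` to the point whose edge out of `o` lies in the orbit of the edge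
      -- from `l₀` to `o`.
      refine hq.eq_zero_of_sum_eq (e₁.trans e₂.symm) (Equiv.bijective _) _ fun l₀ => ?_
      have hσ : pointLabel Γ (e₂.symm (e₁ l₀)) = lineLabel Γ l₀ := e₂.apply_symm_apply _
      rw [← hq.sum_sum_sum_eq _ h0 l₀]
      change ∑ l, linkFun f o (e₂.symm (e₁ l₀)) l = _
      -- Reindexing by two rotations turns the condition on `edge₂` into one on `edge₁`, so the sum
      -- runs over the points of `l₀` and its terms are values of `f` at doubly rotated cells, where
      -- `hM` applies.
      rw [← sum_edge₂_eq hΓ, hσ, ← DirectedCell.rotate_bijective.sum_comp,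
        ← DirectedCell.rotate_bijective.sum_comp]
      simp only [DirectedCell.edge₂_rotate_rotate]
      rw [sum_edge₁_eq hΓ (fun a => f a.rotate.rotate)]
      refine Finset.sum_congr rfl fun p₀ _ => ?_
      rw [linkFun]
      split_ifs with h₀
      · rw [hM, sum_transM hΓ]
      · rfl
    have hG : ∀ l, ∑ p, linkFun f o p l = 0 := by
      let e₁ := Equiv.ofBijective _ hP
      let e₂ := Equiv.ofBijective _ hL
      refine hq.flip.eq_zero_of_sum_eq (e₁.trans e₂.symm) (Equiv.bijective _) _ fun p₀ => ?_
      have hσ : lineLabel Γ (e₂.symm (e₁ p₀)) = pointLabel Γ p₀ := e₂.apply_symm_apply _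
      rw [← hq.flip.sum_sum_sum_eq (fun l p => linkFun f o p l) (fun l p => h0 p l) p₀]
      change ∑ p, linkFun f o p (e₂.symm (e₁ p₀)) = _
      rw [← sum_edge₁_eq hΓ, hσ, ← DirectedCell.rotate_bijective.sum_comp]
      simp only [DirectedCell.edge₁_rotate]
      rw [sum_edge₂_eq hΓ (fun a => f a.rotate)]
      refine Finset.sum_congr rfl fun l₀ _ => ?_
      rw [linkFun]
      split_ifs with h₀
      · rw [hN, sum_transN hΓ]
      · rfl
    refine ⟨fun a => ?_, fun ξ => ?_, fun ξ => ?_⟩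
    · obtain ⟨p₀, l₀, h₀, rfl⟩ := exists_flagCell_eq hΓ o a
      -- Once the sums over points and lines vanish, the `N` equation at the rotated cell evaluates
      -- to `f` at the cell itself.
      rw [hN (flagCell Γ p₀ l₀ h₀).rotate, sum_transN hΓ,
        hq.flip.sum_sum_eq_of_sum_eq_zero (fun l p => linkFun f o p l) (fun l p => h0 p l) hG hF h₀]
      exact (linkFun_of_incident f h₀).symm
    · obtain ⟨p, rfl⟩ := hP.2 ξ
      rw [sum_edge₂_eq hΓ, hF]
    · obtain ⟨l, rfl⟩ := hL.2 ξ
      rw [sum_edge₁_eq hΓ, hG]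
  · rintro ⟨hr, h₂, h₁⟩
    have hF : ∀ p, ∑ l, linkFun f o p l = 0 := fun p => by rw [← sum_edge₂_eq hΓ, h₂]
    have hG : ∀ l, ∑ p, linkFun f o p l = 0 := fun l => by rw [← sum_edge₁_eq hΓ, h₁]
    constructor
    · intro a
      -- Every cell is a double rotation, so its right vertex may be taken to be `o`.
      obtain ⟨b, rfl⟩ := DirectedCell.rotate_bijective.2 a
      obtain ⟨b, rfl⟩ := DirectedCell.rotate_bijective.2 b
      obtain ⟨p₀, l₀, h₀, rfl⟩ := exists_flagCell_eq hΓ o b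
      rw [sum_transM hΓ, hq.sum_sum_eq_of_sum_eq_zero _ h0 hF hG h₀, ← hr, ← hr]
      exact (linkFun_of_incident f h₀).symm
    · intro a
      obtain ⟨b, rfl⟩ := DirectedCell.rotate_bijective.2 a
      obtain ⟨p₀, l₀, h₀, rfl⟩ := exists_flagCell_eq hΓ o b
      rw [sum_transN hΓ,
        hq.flip.sum_sum_eq_of_sum_eq_zero (fun l p => linkFun f o p l) (fun l p => h0 p l) hG hF h₀,
        ← hr]
      exact (linkFun_of_incident f h₀).symm

end Transfer

end A2Tilde

end

/-! ### From real functionals to an isomorphism of presented spaces. -/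

noncomputable section

namespace A2Tilde

section Presentation

variable {X : Type*} (R R' : Set (FreeAbelianGroup X))

/-- If every real valued function on `X` which satisfies the relations `R'` satisfies the relations
`R`, then the real vector space with relations `R` maps to the one with relations `R'`. -/
theorem exists_linearMap
    (h : ∀ ψ : FreeAbelianGroup X →+ ℝ, (∀ r ∈ R', ψ r = 0) → ∀ r ∈ R, ψ r = 0) :
    ∃ e : (ℝ ⊗[ℤ] (FreeAbelianGroup X ⧸ AddSubgroup.closure R)) →ₗ[ℝ]
        (ℝ ⊗[ℤ] (FreeAbelianGroup X ⧸ AddSubgroup.closure R')),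
      ∀ a, e (1 ⊗ₜ[ℤ] (QuotientAddGroup.mk a)) = 1 ⊗ₜ[ℤ] (QuotientAddGroup.mk a) := by
  let W := ℝ ⊗[ℤ] (FreeAbelianGroup X ⧸ AddSubgroup.closure R')
  let j : FreeAbelianGroup X →+ W :=
    (TensorProduct.mk ℤ ℝ _ 1).toAddMonoidHom.comp (QuotientAddGroup.mk' _)
  have hj' : ∀ r ∈ R', j r = 0 := by
    intro r hr
    have : (QuotientAddGroup.mk r : FreeAbelianGroup X ⧸ AddSubgroup.closure R') = 0 :=
      (QuotientAddGroup.eq_zero_iff r).2 (AddSubgroup.subset_closure hr)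
    show (1 : ℝ) ⊗ₜ[ℤ] (QuotientAddGroup.mk r) = 0
    rw [this, TensorProduct.tmul_zero]
  have hj : ∀ r ∈ R, j r = 0 := by
    intro r hr
    -- Linear functionals separate the points of a real vector space, and each one composed with `j`
    -- is a real function satisfying `R'`.
    refine (Module.forall_dual_apply_eq_zero_iff ℝ (j r)).1 fun ψ => ?_
    refine h (ψ.toAddMonoidHom.comp j) (fun s hs => ?_) r hr
    show ψ (j s) = 0
    rw [hj' s hs, map_zero]
  let k : (FreeAbelianGroup X ⧸ AddSubgroup.closure R) →+ W :=
    QuotientAddGroup.lift _ j ((AddSubgroup.closure_le j.ker).2 hj)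
  exact ⟨k.toIntLinearMap.liftBaseChange ℝ, fun a => by
    rw [LinearMap.liftBaseChange_tmul, one_smul]; rfl⟩

/-- Both composites fix the elements `1 ⊗ a`, which span over `ℝ`. -/
theorem exists_linearEquiv
    (h : ∀ ψ : FreeAbelianGroup X →+ ℝ, (∀ r ∈ R, ψ r = 0) ↔ ∀ r ∈ R', ψ r = 0) :
    ∃ e : (ℝ ⊗[ℤ] (FreeAbelianGroup X ⧸ AddSubgroup.closure R)) ≃ₗ[ℝ]
        (ℝ ⊗[ℤ] (FreeAbelianGroup X ⧸ AddSubgroup.closure R')),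
      ∀ a, e (1 ⊗ₜ[ℤ] (QuotientAddGroup.mk a)) = 1 ⊗ₜ[ℤ] (QuotientAddGroup.mk a) := by
  obtain ⟨e, he⟩ := exists_linearMap R R' fun ψ => (h ψ).2
  obtain ⟨e', he'⟩ := exists_linearMap R' R fun ψ => (h ψ).1
  refine ⟨LinearEquiv.ofLinearMap e e' ?_ ?_, he⟩ <;>
  · refine TensorProduct.AlgebraTensorModule.curry_injective ?_
    ext a
    induction a using QuotientAddGroup.induction_on with | H a
    simp [he, he']

end Presentation

variable {V : Type*} [DecidableEq V] {Δ : Building V} {Γ : Type*} [Group Γ] [MulAction Γ V]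

open Classical in
theorem forall_relations_iff [Fintype (DirectedCell Δ Γ)]
    (ψ : FreeAbelianGroup (DirectedCell Δ Γ) →+ ℝ) :
    (∀ r ∈ relations Δ Γ, ψ r = 0) ↔
      ((∀ a, ψ (.of a) = ∑ b, (transM Δ Γ a b : ℝ) * ψ (.of b)) ∧
        (∀ a, ψ (.of a) = ∑ b, (transN Δ Γ a b : ℝ) * ψ (.of b))) := by
  have key : ∀ (T : Matrix (DirectedCell Δ Γ) (DirectedCell Δ Γ) ℤ) (a : DirectedCell Δ Γ),
      ψ (.of a - ∑ᶠ b, T a b • .of b) = 0 ↔ ψ (.of a) = ∑ b, (T a b : ℝ) * ψ (.of b) := by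
    intro T a
    rw [finsum_eq_sum_of_fintype, map_sub, map_sum, sub_eq_zero]
    simp only [map_zsmul, zsmul_eq_mul]
  constructor
  · exact fun h => ⟨fun a => (key _ a).1 (h _ (Or.inl ⟨a, rfl⟩)),
      fun a => (key _ a).1 (h _ (Or.inr ⟨a, rfl⟩))⟩
  · rintro ⟨h₁, h₂⟩ r (⟨a, rfl⟩ | ⟨a, rfl⟩)
    · exact (key _ a).2 (h₁ a)
    · exact (key _ a).2 (h₂ a)

open Classical in
theorem forall_relations₀_iff [Fintype (DirectedCell Δ Γ)]
    (ψ : FreeAbelianGroup (DirectedCell Δ Γ) →+ ℝ) :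
    (∀ r ∈ relations₀ Δ Γ, ψ r = 0) ↔
      ((∀ a : DirectedCell Δ Γ, ψ (.of a) = ψ (.of a.rotate)) ∧
      (∀ ξ : EdgeLabel Δ Γ,
        (∑ a : DirectedCell Δ Γ, if a.edge₂ = ξ then ψ (.of a) else 0) = 0) ∧
      (∀ ξ : EdgeLabel Δ Γ,
        (∑ a : DirectedCell Δ Γ, if a.edge₁ = ξ then ψ (.of a) else 0) = 0)) := by
  have key : ∀ (edge : DirectedCell Δ Γ → EdgeLabel Δ Γ) (ξ : EdgeLabel Δ Γ),
      ψ (∑ᶠ (a : DirectedCell Δ Γ) (_ : edge a = ξ), .of a) =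
        ∑ a : DirectedCell Δ Γ, if edge a = ξ then ψ (.of a) else 0 := by
    intro edge ξ
    simp only [finsum_eq_if, finsum_eq_sum_of_fintype, map_sum]
    refine Finset.sum_congr rfl fun a _ => ?_
    split_ifs <;> simp
  constructor
  · refine fun h => ⟨fun a => ?_, fun ξ => ?_, fun ξ => ?_⟩
    · have := h _ (Or.inl (Or.inl (Or.inl ⟨a, rfl⟩)))
      rwa [map_sub, sub_eq_zero] at this
    · rw [← key]; exact h _ (Or.inl (Or.inr ⟨ξ, rfl⟩))
    · rw [← key]; exact h _ (Or.inr ⟨ξ, rfl⟩)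
  · rintro ⟨h₁, h₂, h₃⟩ r (((⟨a, rfl⟩ | ⟨a, rfl⟩) | ⟨ξ, rfl⟩) | ⟨ξ, rfl⟩)
    · rw [map_sub, sub_eq_zero]; exact h₁ a
    · rw [map_sub, sub_eq_zero]; exact h₁ a.rotate
    · exact (key _ ξ).trans (h₂ ξ)
    · exact (key _ ξ).trans (h₃ ξ)

end A2Tilde

end

open A2Tilde in
theorem proposition3p5 {V : Type*} [DecidableEq V] (Δ : Building V)
    {Γ : Type*} [Group Γ] [MulAction Γ V] (hΓ : IsA2TildeGroup Δ Γ)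
    (htf : ∀ g : Γ, g ≠ 1 → ¬ IsOfFinOrder g) :
    ∃ e : (ℝ ⊗[ℤ] GroupC Δ Γ) ≃ₗ[ℝ] (ℝ ⊗[ℤ] GroupC₀ Δ Γ),
      ∀ a : DirectedCell Δ Γ, e (1 ⊗ₜ[ℤ] GroupC.of a) = 1 ⊗ₜ[ℤ] GroupC₀.of a := by
  have : Finite (DirectedCell Δ Γ) := finite_directedCell Δ Γ hΓ
  have : Fintype (DirectedCell Δ Γ) := Fintype.ofFinite _
  obtain ⟨e, he⟩ := exists_linearEquiv (relations Δ Γ) (relations₀ Δ Γ) fun ψ => by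
    rw [forall_relations_iff, forall_relations₀_iff]
    exact transition_iff hΓ fun a => ψ (.of a)
  exact ⟨e, fun a => he (.of a)⟩
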